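/- Let $X$ be a finite-dimensional real linear space equipped with a norm $\|\cdot\|$ and with an inner product, whose norm is denoted $|\cdot|$, and let $m$ be an integer with $1\le m\le \dim X-1$. Let $\mathbf{G}_m(X)$ be the set of $m$-dimensional linear subspaces of $X$, with the metric $d(W_1,W_2)=|||\pi_{W_1}-\pi_{W_2}|||$, where $\pi_W$ is the orthogonal projection onto $W$ and $|||\cdot|||$ is the operator norm associated with $|\cdot|$. Let $\mathrm{Hom}_m(X,X)$ be the space of linear maps $X\to X$ of rank at most $m$, with the metric of $|||\cdot|||$, and let $\mathscr{M}_1(\mathrm{Hom}_m(X,X))$ be the space of Borel probability measures on it, with the topology of weak convergence. Let $\mathscr{H}^m_{\|\cdot\|}$ be the $m$-dimensional Hausdorff (outer) measure of $(X,\|\cdot\|)$. A measure $\mu\in\mathscr{M}_1(\mathrm{Hom}_m(X,X))$ is called a density contractor on $W\in\mathbf{G}_m(X)$ if (1) $\mu(\{\pi : \operatorname{im}\pi\not\subset W\})=0$; and (2) for every $V\in\mathbf{G}_m(X)$ and every Borel set $A\subset V$, $$\int_{\mathrm{Hom}_m(X,X)}\mathscr{H}^m_{\|\cdot\|}(\pi(A))\,d\mu(\pi)\le\mathscr{H}^m_{\|\cdot\|}(A),$$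 with equality when $V=W$. Then: (a) The set of pairs $(W,\mu)\in\mathbf{G}_m(X)\times\mathscr{M}_1(\mathrm{Hom}_m(X,X))$ such that $\mu$ is a density contractor on $W$ is a Borel subset of $\mathbf{G}_m(X)\times\mathscr{M}_1(\mathrm{Hom}_m(X,X))$. (b) If every $W\in\mathbf{G}_m(X)$ admits a density contractor, then there is a universally measurable map $W\mapsto\mu_W$ from $\mathbf{G}_m(X)$ to $\mathscr{M}_1(\mathrm{Hom}_m(X,X))$ such that $\mu_W$ is a density contractor on $W$ for every $W\in\mathbf{G}_m(X)$. (Universally measurable: the preimage of every Borel set is measurable with respect to the completion of every $\sigma$-finite Borel measure on $\mathbf{G}_m(X)$.) -/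

import Mathlib

open MeasureTheory Module
open scoped ENNReal

noncomputable section

/-- The Grassmannian of `m`-dimensional linear subspaces of `X`. -/
def Grass (X : Type*) [NormedAddCommGroup X] [InnerProductSpace ℝ X] (m : ℕ) : Type _ :=
  {W : Submodule ℝ X // finrank ℝ W = m}

/-- The orthogonal projection `π_W : X → X` onto `W`, as a bounded operator. -/
def Grass.proj {X : Type*} [NormedAddCommGroup X] [InnerProductSpace ℝ X]
    [FiniteDimensional ℝ X] {m : ℕ} (W : Grass X m) : X →L[ℝ] X :=
  W.1.starProjection

theorem Grass.proj_injective {X : Type*} [NormedAddCommGroup X] [InnerProductSpace ℝ X]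
    [FiniteDimensional ℝ X] {m : ℕ} :
    Function.Injective (Grass.proj : Grass X m → (X →L[ℝ] X)) := by
  intro W₁ W₂ h
  exact Subtype.ext (Submodule.starProjection_inj.1 h)

/-- The metric `d(W₁, W₂) = ‖π_{W₁} - π_{W₂}‖` (operator norm) on the Grassmannian. -/
instance Grass.instMetricSpace {X : Type*} [NormedAddCommGroup X] [InnerProductSpace ℝ X]
    [FiniteDimensional ℝ X] {m : ℕ} : MetricSpace (Grass X m) :=
  MetricSpace.induced Grass.proj Grass.proj_injective inferInstance

instance Grass.instMeasurableSpace {X : Type*} [NormedAddCommGroup X] [InnerProductSpace ℝ X]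
    [FiniteDimensional ℝ X] {m : ℕ} : MeasurableSpace (Grass X m) :=
  borel (Grass X m)

instance Grass.instBorelSpace {X : Type*} [NormedAddCommGroup X] [InnerProductSpace ℝ X]
    [FiniteDimensional ℝ X] {m : ℕ} : BorelSpace (Grass X m) :=
  ⟨rfl⟩

/-- `Hom_m(X, X)`: the linear maps `X → X` of rank at most `m`, with the metric (and the Borel
σ-algebra) inherited from the space of all linear maps with the operator norm. -/
abbrev HomRankLE (X : Type*) [NormedAddCommGroup X] [InnerProductSpace ℝ X] (m : ℕ) : Type _ :=
  {π : X →L[ℝ] X // finrank ℝ (LinearMap.range (π : X →ₗ[ℝ] X)) ≤ m}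

/-- The metric structure `(x, y) ↦ ν (x - y)` of a norm `ν` (a seminorm that vanishes only at
the origin). -/
@[reducible]
def normEMetric {X : Type*} [AddCommGroup X] [Module ℝ X] (ν : Seminorm ℝ X)
    (hν : ∀ x, ν x = 0 → x = 0) : EMetricSpace X where
  edist x y := ENNReal.ofReal (ν (x - y))
  edist_self x := by simp
  edist_comm x y := by rw [map_sub_rev]
  edist_triangle x y z := by
    rw [← ENNReal.ofReal_add (apply_nonneg ν _) (apply_nonneg ν _)]
    refine ENNReal.ofReal_le_ofReal ?_
    have h := map_add_le_add ν (x - y) (y - z)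
    rwa [sub_add_sub_cancel] at h
  eq_of_edist_eq_zero {x y} h := by
    have h' : ν (x - y) = 0 :=
      le_antisymm (ENNReal.ofReal_eq_zero.1 h) (apply_nonneg ν _)
    exact sub_eq_zero.1 (hν _ h')

/-- The `m`-dimensional Hausdorff outer measure of the normed space `(X, ν)`, with the usual
normalization: a set `E` in a cover contributes `α(m) 2⁻ᵐ (diam E)ᵐ`, where `α(m)` is the Lebesgue
measure of the Euclidean unit ball of `ℝᵐ`. -/
def normHausdorff {X : Type*} [AddCommGroup X] [Module ℝ X] (ν : Seminorm ℝ X)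
    (hν : ∀ x, ν x = 0 → x = 0) (m : ℕ) : OuterMeasure X :=
  (volume (Metric.ball (0 : EuclideanSpace ℝ (Fin m)) 1) / 2 ^ m) •
    @OuterMeasure.mkMetric X (normEMetric ν hν) (fun r => r ^ m)

/-- `μ` is a density contractor on `W` with respect to the `m`-dimensional Hausdorff measure
of the norm `ν`. -/
structure IsDensityContractor {X : Type*} [NormedAddCommGroup X] [InnerProductSpace ℝ X]
    [FiniteDimensional ℝ X] [MeasurableSpace X] [BorelSpace X] {m : ℕ}
    (ν : Seminorm ℝ X) (hν : ∀ x, ν x = 0 → x = 0)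
    (W : Grass X m) (μ : ProbabilityMeasure (HomRankLE X m)) : Prop where
  supported : (μ : Measure (HomRankLE X m))
    {π | ¬ LinearMap.range (π.1 : X →ₗ[ℝ] X) ≤ W.1} = 0
  le : ∀ (V : Grass X m) (A : Set X), MeasurableSet A → A ⊆ (V.1 : Set X) →
    ∫⁻ π, normHausdorff ν hν m (π.1 '' A) ∂(μ : Measure (HomRankLE X m)) ≤
      normHausdorff ν hν m A
  eq : ∀ A : Set X, MeasurableSet A → A ⊆ (W.1 : Set X) →
    ∫⁻ π, normHausdorff ν hν m (π.1 '' A) ∂(μ : Measure (HomRankLE X m)) =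
      normHausdorff ν hν m A

/-- `f` is universally measurable: the preimage of every Borel set is measurable with respect to
the completion of every σ-finite Borel measure. -/
def UniversallyMeasurable {α β : Type*} [TopologicalSpace α] [MeasurableSpace α] [BorelSpace α]
    [TopologicalSpace β] (f : α → β) : Prop :=
  ∀ B : Set β, MeasurableSet[borel β] B →
    ∀ (ρ : Measure α) [SigmaFinite ρ], NullMeasurableSet (f ⁻¹' B) ρ

end

/-! A linear map scales the `m`-dimensional Hausdorff measure of all subsets of an `m`-plane `V` by
one constant. So the Borel sets `A` in the definition of a density contractor may be replaced by the
Euclidean unit ball of `V` (`isDensityContractor_iff`). The volume of the image of that ball is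
lower semicontinuous in the plane and the map (`lowerSemicontinuous_imageVol`), and integrals
inherit this in the plane and the measure (`lowerSemicontinuous_lintegral_prod`). Hence the support
condition and the inequality for each fixed `V` define closed sets, which stay closed under
intersection over uncountably many `V`. The equality on `W` compares two Borel functions. This
proves (a).

For (b), the Grassmannian and the space of probability measures are Polish, so the Borel set of (a)
is analytic. Jankov–von Neumann selection applies: the set is a continuous image of the Baire space,
and the lexicographically least parameter over each `W` depends on `W` measurably for any σ-algebra
containing the analytic sets. These are universally measurable because a continuous image of the
Baire space is approximated in measure from inside by compact sets. -/

/-! ### Lexicographically least points in the Baire space. -/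

/-- The sequence `s` with `s n = F n s'`, where `s'` is `s` cut off at `n`. -/
noncomputable def truncRec (F : ℕ → (ℕ → ℕ) → ℕ) (n : ℕ) : ℕ :=
  F n (fun i => if _h : i < n then truncRec F i else 0)
termination_by n

theorem truncRec_eq (F : ℕ → (ℕ → ℕ) → ℕ)
    (hF : ∀ n s t, (∀ i < n, s i = t i) → F n s = F n t) (n : ℕ) :
    truncRec F n = F n (truncRec F) := by
  rw [truncRec]
  apply hF
  intro i hi
  simp [hi]

/-- The lexicographically least element of a nonempty closed subset of the Baire space. -/
noncomputable def leftmost (C : Set (ℕ → ℕ)) : ℕ → ℕ :=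
  truncRec fun n s => sInf {k | ∃ x ∈ C, (∀ i < n, x i = s i) ∧ x n = k}

theorem leftmost_apply (C : Set (ℕ → ℕ)) (n : ℕ) :
    leftmost C n = sInf {k | ∃ x ∈ C, (∀ i < n, x i = leftmost C i) ∧ x n = k} := by
  rw [leftmost, truncRec_eq]
  intro n s t h
  congr 1
  ext k
  constructor
  · rintro ⟨x, hx, h1, h2⟩
    exact ⟨x, hx, fun i hi => (h1 i hi).trans (h i hi), h2⟩
  · rintro ⟨x, hx, h1, h2⟩
    exact ⟨x, hx, fun i hi => (h1 i hi).trans (h i hi).symm, h2⟩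

theorem exists_mem_eq_leftmost {C : Set (ℕ → ℕ)} (hC : C.Nonempty) (n : ℕ) :
    ∃ x ∈ C, ∀ i < n, x i = leftmost C i := by
  induction n with
  | zero => exact ⟨hC.some, hC.some_mem, by simp⟩
  | succ n ih =>
    obtain ⟨x, hx, h⟩ := ih
    have : sInf {k | ∃ x ∈ C, (∀ i < n, x i = leftmost C i) ∧ x n = k} ∈
        {k | ∃ x ∈ C, (∀ i < n, x i = leftmost C i) ∧ x n = k} :=
      Nat.sInf_mem ⟨x n, x, hx, h, rfl⟩
    rw [← leftmost_apply] at this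
    obtain ⟨z, hz, h1, h2⟩ := this
    refine ⟨z, hz, fun i hi => ?_⟩
    rcases Nat.lt_succ_iff_lt_or_eq.1 hi with h | rfl
    exacts [h1 i h, h2]

theorem leftmost_mem {C : Set (ℕ → ℕ)} (hC : C.Nonempty) (hc : IsClosed C) :
    leftmost C ∈ C := by
  choose x hx h using exists_mem_eq_leftmost hC
  refine hc.mem_of_tendsto (f := x) (b := Filter.atTop) ?_ (Filter.Eventually.of_forall hx)
  rw [tendsto_pi_nhds]
  intro i
  refine tendsto_const_nhds.congr' ?_
  filter_upwards [Filter.eventually_gt_atTop i] with n hn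
  exact (h n i hn).symm

/-- Once the first `n` entries are known, the next one is the least `j` for which `y` lies in the
image of an open cylinder. There are only countably many possible initial segments, so induction on
`n` applies. -/
theorem measurable_leftmost_fiber {Y : Type*} [MeasurableSpace Y] (f : (ℕ → ℕ) → Y)
    (hf : ∀ U : Set (ℕ → ℕ), IsOpen U → MeasurableSet (f '' U)) :
    Measurable fun y => leftmost (f ⁻¹' {y}) := by
  rw [measurable_pi_iff]
  intro n
  induction n using Nat.strong_induction_on with
  | _ n ih =>
    refine measurable_to_countable' fun k => ?_
    have hA : ∀ (u : Fin n → ℕ) (j : ℕ),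
        MeasurableSet (f '' {x | (∀ i : Fin n, x i = u i) ∧ x n = j}) := by
      intro u j
      refine hf _ (IsOpen.inter ?_ ?_)
      · have : {x : ℕ → ℕ | ∀ i : Fin n, x i = u i} = ⋂ i : Fin n, {x | x i = u i} := by
          ext; simp
        change IsOpen {x : ℕ → ℕ | ∀ i : Fin n, x i = u i}
        rw [this]
        exact isOpen_iInter_of_finite fun i =>
          isOpen_discrete {u i} |>.preimage (continuous_apply (A := fun _ : ℕ => ℕ) i)
      · exact isOpen_discrete {j} |>.preimage (continuous_apply (A := fun _ : ℕ => ℕ) n)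
    have hS : ∀ u : Fin n → ℕ, MeasurableSet {y : Y |
        sInf {j | y ∈ f '' {x | (∀ i : Fin n, x i = u i) ∧ x n = j}} = k} := by
      intro u
      -- Since `sInf ∅ = 0`, points `y` in none of the images must be added when `k = 0`.
      have h2 : {y : Y | sInf {j | y ∈ f '' {x | (∀ i : Fin n, x i = u i) ∧ x n = j}} = k} =
          ({y | ∀ j, y ∉ f '' {x | (∀ i : Fin n, x i = u i) ∧ x n = j}} ∩ {_y | k = 0}) ∪
          (f '' {x | (∀ i : Fin n, x i = u i) ∧ x n = k} ∩
            {y | ∀ j < k, y ∉ f '' {x | (∀ i : Fin n, x i = u i) ∧ x n = j}}) := by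
        ext y
        set S := {j | y ∈ f '' {x | (∀ i : Fin n, x i = u i) ∧ x n = j}} with hSdef
        change sInf S = k ↔ ((∀ j, j ∉ S) ∧ k = 0) ∨ (k ∈ S ∧ ∀ j < k, j ∉ S)
        constructor
        · rintro rfl
          by_cases hne : S.Nonempty
          · exact Or.inr ⟨Nat.sInf_mem hne, fun j hj => Nat.notMem_of_lt_sInf hj⟩
          · rw [Set.not_nonempty_iff_eq_empty] at hne
            left; simp [hne]
        · rintro (⟨h1, rfl⟩ | ⟨h1, h2⟩)
          · rw [Set.eq_empty_of_forall_notMem h1]; simp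
          · refine le_antisymm (Nat.sInf_le h1) (not_lt.1 fun h => h2 _ h (Nat.sInf_mem ⟨k, h1⟩))
      rw [h2]
      refine MeasurableSet.union (MeasurableSet.inter ?_ (MeasurableSet.const _))
        ((hA u k).inter ?_)
      · have : {y | ∀ j, y ∉ f '' {x | (∀ i : Fin n, x i = u i) ∧ x n = j}} =
            ⋂ j, (f '' {x | (∀ i : Fin n, x i = u i) ∧ x n = j})ᶜ := by ext; simp
        rw [this]
        exact MeasurableSet.iInter fun j => (hA u j).compl
      · have : {y | ∀ j < k, y ∉ f '' {x | (∀ i : Fin n, x i = u i) ∧ x n = j}} =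
            ⋂ j, ⋂ (_ : j < k), (f '' {x | (∀ i : Fin n, x i = u i) ∧ x n = j})ᶜ := by ext; simp
        rw [this]
        exact MeasurableSet.iInter fun j => MeasurableSet.iInter fun _ => (hA u j).compl
    have key : (fun y => leftmost (f ⁻¹' {y}) n) ⁻¹' {k} = ⋃ u : Fin n → ℕ,
        {y | ∀ i : Fin n, leftmost (f ⁻¹' {y}) i = u i} ∩ {y : Y |
        sInf {j | y ∈ f '' {x | (∀ i : Fin n, x i = u i) ∧ x n = j}} = k} := by
      ext y
      have h3 : ∀ u : Fin n → ℕ, (∀ i : Fin n, leftmost (f ⁻¹' {y}) i = u i) →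
          leftmost (f ⁻¹' {y}) n =
            sInf {j | y ∈ f '' {x | (∀ i : Fin n, x i = u i) ∧ x n = j}} := by
        intro u hu
        rw [leftmost_apply]
        congr 1
        ext j
        constructor
        · rintro ⟨x, hx, h1, h2⟩
          exact ⟨x, ⟨fun i => (h1 i i.2).trans (hu i), h2⟩, hx⟩
        · rintro ⟨x, ⟨h1, h2⟩, hx⟩
          exact ⟨x, hx, fun i hi => (h1 ⟨i, hi⟩).trans (hu ⟨i, hi⟩).symm, h2⟩
      simp only [Set.mem_preimage, Set.mem_singleton_iff, Set.mem_iUnion, Set.mem_inter_iff,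
        Set.mem_ofPred_eq]
      constructor
      · intro h
        exact ⟨fun i => leftmost (f ⁻¹' {y}) i, fun _ => rfl, by rw [← h3 _ fun _ => rfl]; exact h⟩
      · rintro ⟨u, hu, h⟩
        rw [h3 u hu, h]
    rw [key]
    refine MeasurableSet.iUnion fun u => MeasurableSet.inter ?_ (hS u)
    have : {y | ∀ i : Fin n, leftmost (f ⁻¹' {y}) i = u i} =
        ⋂ i : Fin n, (fun y => leftmost (f ⁻¹' {y}) i) ⁻¹' {u i} := by ext; simp
    rw [this]
    exact MeasurableSet.iInter fun i => ih i i.2 (measurableSet_singleton _)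

/-! ### Analytic sets: universal measurability and selection. -/

/-- A sequence `s` such that `f` maps every set `{t | t i ≤ s i for i < n}` to a set of outer
measure greater than `a`. -/
theorem exists_forall_lt_measure_image {Y : Type*} [MeasurableSpace Y] (ρ : Measure Y)
    (f : (ℕ → ℕ) → Y) {a : ℝ≥0∞} (ha : a < ρ (Set.range f)) :
    ∃ s : ℕ → ℕ, ∀ n, a < ρ (f '' {t | ∀ i < n, t i ≤ s i}) := by
  set s : ℕ → ℕ := truncRec fun n s =>
    sInf {k | a < ρ (f '' {t | (∀ i < n, t i ≤ s i) ∧ t n ≤ k})} with hs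
  have hs' : ∀ n, s n = sInf {k | a < ρ (f '' {t | (∀ i < n, t i ≤ s i) ∧ t n ≤ k})} := by
    intro n
    rw [hs, truncRec_eq]
    intro n s t h
    have : ∀ k, {u : ℕ → ℕ | (∀ i < n, u i ≤ s i) ∧ u n ≤ k} =
        {u : ℕ → ℕ | (∀ i < n, u i ≤ t i) ∧ u n ≤ k} := by
      intro k
      ext u
      simp +contextual [h]
    simp [this]
  refine ⟨s, fun n => ?_⟩
  induction n with
  | zero => simpa [Set.image_univ] using ha
  | succ n ih =>
    have hU : f '' {t | ∀ i < n, t i ≤ s i} =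
        ⋃ k, f '' {t | (∀ i < n, t i ≤ s i) ∧ t n ≤ k} := by
      rw [← Set.image_iUnion]
      congr 1
      ext t
      simp only [Set.mem_ofPred_eq, Set.mem_iUnion, exists_and_left]
      exact ⟨fun h => ⟨h, t n, le_rfl⟩, fun h => h.1⟩
    have hm : Monotone fun k => f '' {t | (∀ i < n, t i ≤ s i) ∧ t n ≤ k} :=
      fun k l hkl => Set.image_mono fun t ht => ⟨ht.1, ht.2.trans hkl⟩
    -- Continuity from below holds for increasing unions of arbitrary sets, so the images need not
    -- be measurable.
    rw [hU, hm.measure_iUnion, lt_iSup_iff] at ih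
    obtain ⟨k, hk⟩ := ih
    have := Nat.sInf_mem (s := {k | a < ρ (f '' {t | (∀ i < n, t i ≤ s i) ∧ t n ≤ k})}) ⟨k, hk⟩
    rw [← hs'] at this
    refine lt_of_lt_of_le this (measure_mono (Set.image_mono ?_))
    rintro t ⟨h1, h2⟩ i hi
    rcases Nat.lt_succ_iff_lt_or_eq.1 hi with h | rfl
    exacts [h1 i h, h2]

theorem isCompact_setOf_forall_le (s : ℕ → ℕ) : IsCompact {t : ℕ → ℕ | ∀ i, t i ≤ s i} := by
  have : {t : ℕ → ℕ | ∀ i, t i ≤ s i} = Set.univ.pi fun i => Set.Iic (s i) := by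
    ext; simp [Pi.le_def]
  rw [this]
  exact isCompact_univ_pi fun i => (Set.finite_Iic (s i)).isCompact

theorem exists_setOf_forall_lt_le_subset {O : Set (ℕ → ℕ)} (hO : IsOpen O) (s : ℕ → ℕ)
    (h : {t : ℕ → ℕ | ∀ i, t i ≤ s i} ⊆ O) : ∃ n, {t | ∀ i < n, t i ≤ s i} ⊆ O := by
  by_contra! H
  have H' : ∀ n, ∃ t : ℕ → ℕ, (∀ i < n, t i ≤ s i) ∧ t ∉ O := fun n => by
    obtain ⟨t, h1, h2⟩ := Set.not_subset.1 (H n)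
    exact ⟨t, h1, h2⟩
  choose t ht htO using H'
  -- Capping `t n` by `s` moves it into the compact set without changing its entries below `n`, so
  -- both sequences have the same limit along `φ`.
  obtain ⟨u, hu, φ, hφ, hlim⟩ := (isCompact_setOf_forall_le s).tendsto_subseq
    (x := fun n i => min (t n i) (s i)) fun n i => min_le_right _ _
  have hlim' : Filter.Tendsto (fun n => t (φ n)) Filter.atTop (nhds u) := by
    rw [tendsto_pi_nhds] at hlim ⊢
    intro i
    refine (hlim i).congr' ?_
    filter_upwards [hφ.tendsto_atTop.eventually_gt_atTop i] with n hn
    exact min_eq_left (ht (φ n) i hn)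
  exact hO.isClosed_compl.mem_of_tendsto hlim' (Filter.Eventually.of_forall fun n => htO (φ n))
    (h hu)

/-- A continuous image of the Baire space is measurable with respect to the completion of every
finite Borel measure. -/
theorem nullMeasurableSet_range_of_continuous {Y : Type*} [TopologicalSpace Y]
    [TopologicalSpace.PseudoMetrizableSpace Y] [T2Space Y] [MeasurableSpace Y] [BorelSpace Y]
    {f : (ℕ → ℕ) → Y} (hf : Continuous f) (ρ : Measure Y) [IsFiniteMeasure ρ] :
    NullMeasurableSet (Set.range f) ρ := by
  let := TopologicalSpace.pseudoMetrizableSpacePseudoMetric Y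
  have key : ∀ a < ρ (Set.range f), ∃ K ⊆ Set.range f, MeasurableSet K ∧ a ≤ ρ K := by
    intro a ha
    obtain ⟨s, hs⟩ := exists_forall_lt_measure_image ρ f ha
    refine ⟨f '' {t | ∀ i, t i ≤ s i}, Set.image_subset_range _ _,
      ((isCompact_setOf_forall_le s).image hf).measurableSet, ?_⟩
    -- By outer regularity it suffices to bound open `O` containing the compact image; such an `O`
    -- already contains the image of a set constrained in finitely many coordinates, of measure
    -- above `a`.
    rw [Set.measure_eq_iInf_isOpen]
    refine le_iInf₂ fun O hO => le_iInf fun hO' => ?_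
    obtain ⟨n, hn⟩ := exists_setOf_forall_lt_le_subset (hO'.preimage hf) s
      (Set.image_subset_iff.1 hO)
    exact (hs n).le.trans (measure_mono (Set.image_subset_iff.2 hn))
  by_cases h0 : ρ (Set.range f) = 0
  · exact NullMeasurableSet.of_null h0
  obtain ⟨a, -, ha, hlim⟩ := exists_seq_strictMono_tendsto' (pos_iff_ne_zero.2 h0)
  choose K hK hKm hKa using fun n => key (a n) (ha n).2
  have hle : ρ (Set.range f) ≤ ρ (⋃ n, K n) :=
    le_of_tendsto' hlim fun n => (hKa n).trans (measure_mono (Set.subset_iUnion K n))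
  have hsub : ⋃ n, K n ⊆ Set.range f := Set.iUnion_subset hK
  have hm : MeasurableSet (⋃ n, K n) := MeasurableSet.iUnion hKm
  refine NullMeasurableSet.congr hm.nullMeasurableSet ?_
  exact ae_eq_of_subset_of_measure_ge hsub hle hm.nullMeasurableSet (measure_ne_top _ _)

/-- Analytic sets are universally measurable. -/
theorem MeasureTheory.AnalyticSet.nullMeasurableSet {Y : Type*} [TopologicalSpace Y]
    [TopologicalSpace.PseudoMetrizableSpace Y] [T2Space Y] [MeasurableSpace Y] [BorelSpace Y]
    {A : Set Y} (hA : AnalyticSet A) (ρ : Measure Y) [SigmaFinite ρ] : NullMeasurableSet A ρ := by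
  rw [AnalyticSet] at hA
  rcases hA with rfl | ⟨f, hf, rfl⟩
  · exact MeasurableSet.empty.nullMeasurableSet
  · exact (nullMeasurableSet_range_of_continuous hf ρ.toFinite).mono_ac
      (absolutelyContinuous_toFinite ρ)

/-- **Jankov–von Neumann selection**: an analytic subset of `Y × Z` with full projection to `Y`
contains the graph of a universally measurable map. -/
theorem exists_universallyMeasurable_selection {Y Z : Type*} [TopologicalSpace Y]
    [TopologicalSpace.PseudoMetrizableSpace Y] [T2Space Y] [MeasurableSpace Y] [BorelSpace Y]
    [TopologicalSpace Z] {E : Set (Y × Z)} (hE : AnalyticSet E) (hY : ∀ y, ∃ z, (y, z) ∈ E) :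
    ∃ g : Y → Z, (∀ y, (y, g y) ∈ E) ∧ UniversallyMeasurable g := by
  rw [AnalyticSet] at hE
  rcases hE with rfl | ⟨f, hf, rfl⟩
  · exact ⟨fun y => (hY y).choose, fun y => (hY y).choose_spec.elim,
      fun B _ ρ _ => by
        have : IsEmpty Y := ⟨fun y => (hY y).choose_spec.elim⟩
        rw [Set.eq_empty_of_isEmpty (_ ⁻¹' B)]
        exact MeasurableSet.empty.nullMeasurableSet⟩
  set f₁ : (ℕ → ℕ) → Y := fun x => (f x).1 with hf₁
  have hc₁ : Continuous f₁ := continuous_fst.comp hf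
  have hmem : ∀ y, f₁ (leftmost (f₁ ⁻¹' {y})) = y := by
    intro y
    refine leftmost_mem (C := f₁ ⁻¹' {y}) ?_ (isClosed_singleton.preimage hc₁)
    obtain ⟨z, x, hx⟩ := hY y
    exact ⟨x, by simp [hf₁, hx]⟩
  refine ⟨fun y => (f (leftmost (f₁ ⁻¹' {y}))).2, fun y => ⟨leftmost (f₁ ⁻¹' {y}), ?_⟩, ?_⟩
  · exact Prod.ext (hmem y) rfl
  · intro B hB ρ _
    -- Over the completed σ-algebra of `ρ`, images of open sets are measurable because they are
    -- analytic.
    have hm : Measurable (fun y : NullMeasurableSpace Y ρ => leftmost (f₁ ⁻¹' {(y : Y)})) := by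
      refine measurable_leftmost_fiber (Y := NullMeasurableSpace Y ρ) f₁ fun U hU => ?_
      have : AnalyticSet (f₁ '' U) := hU.analyticSet_image hc₁
      exact this.nullMeasurableSet ρ
    let : MeasurableSpace Z := borel Z
    have : BorelSpace Z := ⟨rfl⟩
    have h2 : Measurable fun x => (f x).2 := (continuous_snd.comp hf).measurable
    exact (h2.comp hm) hB

/-! ### The weak topology: Polishness and semicontinuity of integrals. -/

/-- Pushing probability measures forward along an embedding of metrizable spaces induces the
topology of weak convergence. -/
theorem isInducing_probabilityMeasure_map {H Q : Type*}
    [TopologicalSpace H] [MeasurableSpace H] [BorelSpace H]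
    [TopologicalSpace Q] [TopologicalSpace.PseudoMetrizableSpace Q]
    [TopologicalSpace.SeparableSpace Q]
    [MeasurableSpace Q] [BorelSpace Q] {ι : H → Q} (hι : Topology.IsEmbedding ι) :
    Topology.IsInducing fun μ : ProbabilityMeasure H =>
      μ.map hι.continuous.measurable.aemeasurable := by
  set F : ProbabilityMeasure H → ProbabilityMeasure Q := fun μ =>
      μ.map hι.continuous.measurable.aemeasurable with hF
  have hc : Continuous F := ProbabilityMeasure.continuous_map hι.continuous
  let := TopologicalSpace.pseudoMetrizableSpacePseudoMetric Q
  refine Topology.isInducing_iff_nhds.2 fun μ => le_antisymm (hc.tendsto μ).le_comap ?_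
  change Filter.Tendsto (fun ν => ν) (Filter.comap F (nhds (F μ))) (nhds μ)
  -- Open sets of `H` are preimages of open sets of `Q`, so the open-set criterion of the
  -- portmanteau theorem transfers.
  refine tendsto_of_forall_isOpen_le_liminf' fun G hG => ?_
  obtain ⟨O, hO, rfl⟩ := hι.isInducing.isOpen_iff.1 hG
  have h := ProbabilityMeasure.le_liminf_measure_open_of_tendsto
    (Filter.tendsto_comap (f := F) (x := nhds (F μ))) hO
  simpa only [hF, ProbabilityMeasure.toMeasure_map,
    Measure.map_apply hι.continuous.measurable hO.measurableSet] using h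

/-- `H` embeds in the Hilbert cube, whose probability measures form a compact metrizable space. -/
theorem secondCountableTopology_probabilityMeasure {H : Type*}
    [TopologicalSpace H] [TopologicalSpace.MetrizableSpace H] [SecondCountableTopology H]
    [MeasurableSpace H] [BorelSpace H] :
    SecondCountableTopology (ProbabilityMeasure H) := by
  let := TopologicalSpace.metrizableSpaceMetric H
  obtain ⟨ι, hι⟩ := Metric.PiNatEmbed.exists_embedding_to_hilbert_cube (X := H)
  let := TopologicalSpace.metrizableSpaceMetric (ProbabilityMeasure (ℕ → unitInterval))
  exact (isInducing_probabilityMeasure_map hι).secondCountableTopology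

/-- A Cauchy sequence for the Lévy–Prokhorov metric is tight, so Prokhorov's theorem gives a
convergent subsequence. -/
theorem polishSpace_probabilityMeasure {H : Type*} [MetricSpace H] [ProperSpace H]
    [MeasurableSpace H] [BorelSpace H] : PolishSpace (ProbabilityMeasure H) := by
  have := secondCountableTopology_probabilityMeasure (H := H)
  have e := LevyProkhorov.probabilityMeasureHomeomorph (Ω := H)
  have : SecondCountableTopology (LevyProkhorov (ProbabilityMeasure H)) :=
    e.symm.isInducing.secondCountableTopology
  suffices CompleteSpace (LevyProkhorov (ProbabilityMeasure H)) from
    e.isClosedEmbedding.polishSpace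
  refine Metric.complete_of_cauchySeq_tendsto fun u hu => ?_
  have htight : IsTightMeasureSet {((μ : ProbabilityMeasure H) : Measure H) |
      μ ∈ Set.range fun n => (u n).toMeasure} := by
    rw [isTightMeasureSet_iff_exists_isCompact_measure_compl_le]
    intro ε hε
    obtain ⟨δ, hδ, hδε⟩ : ∃ δ : ℝ, 0 < δ ∧ ENNReal.ofReal δ + ENNReal.ofReal δ ≤ ε := by
      by_cases htop : ε = ∞
      · exact ⟨1, one_pos, htop ▸ le_top⟩
      · refine ⟨ε.toReal / 2, half_pos (ENNReal.toReal_pos hε.ne' htop), ?_⟩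
        rw [← ENNReal.ofReal_add (by positivity) (by positivity), add_halves,
          ENNReal.ofReal_toReal htop]
    obtain ⟨N, hN⟩ := Metric.cauchySeq_iff'.1 hu δ hδ
    have hK : ∀ n, ∃ K : Set H, IsCompact K ∧
        ((u n).toMeasure : Measure H) Kᶜ ≤ ENNReal.ofReal δ := fun n => by
      obtain ⟨K, hK, h⟩ := isTightMeasureSet_iff_exists_isCompact_measure_compl_le.1
        (isTightMeasureSet_singleton (μ := ((u n).toMeasure : Measure H)))
        (ENNReal.ofReal δ) (ENNReal.ofReal_pos.2 hδ)
      exact ⟨K, hK, h _ rfl⟩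
    choose K hK hKδ using hK
    -- From `N` on, being `δ`-close to `u N` leaves mass at most `δ + δ` outside the thickening,
    -- which is compact because `H` is proper.
    refine ⟨(⋃ n ∈ Finset.range N, K n) ∪ Metric.cthickening δ (K N),
      ((Finset.range N).isCompact_biUnion fun n _ => hK n).union (hK N).cthickening, ?_⟩
    rintro _ ⟨_, ⟨n, rfl⟩, rfl⟩
    rcases lt_or_ge n N with hn | hn
    · refine (measure_mono ?_).trans ((hKδ n).trans (le_self_add.trans hδε))
      refine Set.compl_subset_compl.2 (Set.subset_union_of_subset_left ?_ _)
      exact Set.subset_biUnion_of_mem (u := K) (Finset.mem_range.2 hn)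
    · set B := (Metric.cthickening δ (K N))ᶜ with hB
      have hBm : MeasurableSet B := Metric.isClosed_cthickening.measurableSet.compl
      have hd : levyProkhorovEDist ((u n).toMeasure : Measure H) ((u N).toMeasure : Measure H) <
          ENNReal.ofReal δ := by
        rw [← LevyProkhorov.edist_probabilityMeasure_def, edist_dist]
        exact (ENNReal.ofReal_lt_ofReal_iff hδ).2 (hN n hn)
      have h1 := left_measure_le_of_levyProkhorovEDist_lt hd hBm
      rw [ENNReal.toReal_ofReal hδ.le] at h1
      have hsub : Metric.thickening δ B ⊆ (K N)ᶜ := by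
        intro x hx hxK
        obtain ⟨y, hy, hxy⟩ := Metric.mem_thickening_iff.1 hx
        exact hy (Metric.mem_cthickening_of_dist_le y x δ _ hxK (by rw [dist_comm]; exact hxy.le))
      refine (measure_mono (t := B) ?_).trans
        (h1.trans ((add_le_add_left ((measure_mono hsub).trans (hKδ N)) _).trans hδε))
      exact Set.compl_subset_compl.2 Set.subset_union_right
  have hcomp := isCompact_closure_of_isTightMeasureSet htight
  obtain ⟨μ, -, φ, hφ, hlim⟩ := hcomp.tendsto_subseq
    (x := fun n => (u n).toMeasure) fun n => subset_closure (Set.mem_range_self n)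
  refine ⟨LevyProkhorov.ofMeasure μ, tendsto_nhds_of_cauchySeq_of_subseq hu hφ.tendsto_atTop ?_⟩
  exact (LevyProkhorov.continuous_ofMeasure_probabilityMeasure.tendsto μ).comp hlim

/-- By the layer-cake formula the integral is built from measures of the open sets `{f > t}`; the
portmanteau theorem and Fatou's lemma conclude. -/
theorem lowerSemicontinuous_lintegral_ofReal {H : Type*} [TopologicalSpace H]
    [HasOuterApproxClosed H] [TopologicalSpace.PseudoMetrizableSpace H]
    [TopologicalSpace.SeparableSpace H] [MeasurableSpace H] [BorelSpace H] {f : H → ℝ}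
    (hf : LowerSemicontinuous f) (h0 : 0 ≤ f) :
    LowerSemicontinuous fun μ : ProbabilityMeasure H =>
      ∫⁻ x, ENNReal.ofReal (f x) ∂(μ : Measure H) := by
  -- This makes neighbourhood filters countably generated, as Fatou's lemma along `nhds μ` needs.
  let := TopologicalSpace.pseudoMetrizableSpacePseudoMetric (ProbabilityMeasure H)
  rw [lowerSemicontinuous_iff_le_liminf]
  intro μ
  simp_rw [lintegral_eq_lintegral_meas_lt _ (Filter.Eventually.of_forall h0)
    hf.measurable.aemeasurable]
  refine le_trans (lintegral_mono fun t => ?_) (lintegral_liminf_le fun ν => ?_)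
  · exact ProbabilityMeasure.le_liminf_measure_open_of_tendsto
      (L := nhds μ) (μs := fun ν => ν) Filter.tendsto_id (hf.isOpen_preimage t)
  · exact Antitone.measurable fun s t hst => measure_mono fun x hx => lt_of_le_of_lt hst hx

/-- The integral is that of `f` against `δ_y ⊗ μ`, which depends continuously on `(y, μ)`. -/
theorem lowerSemicontinuous_lintegral_prod {Y H : Type*} [MetricSpace Y] [SecondCountableTopology Y]
    [MeasurableSpace Y] [BorelSpace Y] [MetricSpace H] [SecondCountableTopology H]
    [MeasurableSpace H] [BorelSpace H] {f : Y × H → ℝ≥0∞}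
    (hf : LowerSemicontinuous f) (htop : ∀ p, f p ≠ ∞) :
    LowerSemicontinuous fun p : Y × ProbabilityMeasure H =>
      ∫⁻ x, f (p.1, x) ∂(p.2 : Measure H) := by
  have hr : LowerSemicontinuous fun p => (f p).toReal := by
    intro p a ha
    rcases lt_or_ge a 0 with h | h
    · exact Filter.Eventually.of_forall fun q => h.trans_le ENNReal.toReal_nonneg
    · filter_upwards [hf p (ENNReal.ofReal a) ((ENNReal.ofReal_lt_iff_lt_toReal h (htop p)).2 ha)]
        with q hq
      exact (ENNReal.ofReal_lt_iff_lt_toReal h (htop q)).1 hq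
  have h1 := lowerSemicontinuous_lintegral_ofReal hr fun p => ENNReal.toReal_nonneg
  have h2 : Continuous fun p : Y × ProbabilityMeasure H => (diracProba p.1).prod p.2 :=
    ProbabilityMeasure.continuous_prod.comp
      ((continuous_diracProba.comp continuous_fst).prodMk continuous_snd)
  have h3 : LowerSemicontinuous fun p : Y × ProbabilityMeasure H =>
      ∫⁻ x, ENNReal.ofReal (f x).toReal ∂((diracProba p.1).prod p.2 : Measure (Y × H)) :=
    fun p a ha => (h2.tendsto p).eventually (h1 _ a ha)
  convert h3 using 2 with p
  have hm : Measurable fun q => ENNReal.ofReal (f q).toReal := hr.measurable.ennreal_ofReal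
  rw [ProbabilityMeasure.toMeasure_prod, lintegral_prod _ hm.aemeasurable,
    diracProba, ProbabilityMeasure.coe_mk, lintegral_dirac' _ hm.lintegral_prod_right']
  simp [htop]

/-! ### The Grassmannian is Polish. -/

/-- The projections in question are the self-adjoint idempotents of trace `m`, and these are closed
conditions. -/
theorem isClosedEmbedding_grassProj (X : Type*) [NormedAddCommGroup X] [InnerProductSpace ℝ X]
    [FiniteDimensional ℝ X] (m : ℕ) :
    Topology.IsClosedEmbedding (Grass.proj : Grass X m → (X →L[ℝ] X)) := by
  have hiso : Isometry (Grass.proj : Grass X m → (X →L[ℝ] X)) := fun _ _ => rfl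
  have htr : ∀ W : Submodule ℝ X,
      LinearMap.trace ℝ X (W.starProjection : X →ₗ[ℝ] X) = finrank ℝ W := fun W =>
    LinearMap.IsProj.trace ⟨fun x => W.starProjection_apply_mem x,
      fun x hx => Submodule.starProjection_eq_self_iff.2 hx⟩
  have hrange : Set.range (Grass.proj : Grass X m → (X →L[ℝ] X)) =
      {P : X →L[ℝ] X | P * P = P} ∩ {P : X →L[ℝ] X | star P = P} ∩
        {P : X →L[ℝ] X | LinearMap.trace ℝ X (P : X →ₗ[ℝ] X) = m} := by
    ext P
    constructor
    · rintro ⟨W, rfl⟩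
      have h : IsStarProjection (Grass.proj W) := isStarProjection_starProjection
      exact ⟨⟨h.isIdempotentElem, h.isSelfAdjoint⟩, by
        exact (htr W.1).trans (by rw [W.2])⟩
    · rintro ⟨⟨h1, h2⟩, h3⟩
      obtain ⟨W, _, rfl⟩ := isStarProjection_iff_eq_starProjection.1 ⟨h1, h2⟩
      refine ⟨⟨W, ?_⟩, rfl⟩
      have := (htr W).symm.trans h3
      exact_mod_cast this
  refine ⟨hiso.isEmbedding, ?_⟩
  rw [hrange]
  refine ((isClosed_eq (continuous_id.mul continuous_id) continuous_id).inter
    (isClosed_eq continuous_star continuous_id)).inter (isClosed_eq ?_ continuous_const)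
  exact ((LinearMap.trace ℝ X).comp
    (ContinuousLinearMap.coeLM (M := X) (N₃ := X) (R := ℝ) ℝ)).continuous_of_finiteDimensional

instance (X : Type*) [NormedAddCommGroup X] [InnerProductSpace ℝ X]
    [FiniteDimensional ℝ X] (m : ℕ) : PolishSpace (Grass X m) :=
  (isClosedEmbedding_grassProj X m).polishSpace

/-! ### Hausdorff measure of linear images. -/

section HausdorffLinear

open scoped NNReal Topology

/-- A linear map multiplies the Hausdorff measure of top dimension by a constant, which is
positive when the map is injective. -/
theorem exists_hausdorffMeasure_image_eq_mul {V E : Type*}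
    [NormedAddCommGroup V] [NormedSpace ℝ V] [FiniteDimensional ℝ V] [MeasurableSpace V]
    [BorelSpace V] [NormedAddCommGroup E] [NormedSpace ℝ E] [FiniteDimensional ℝ E]
    [MeasurableSpace E] [BorelSpace E] (L : V →L[ℝ] E) :
    ∃ c : ℝ≥0, (c ≠ 0 ↔ Function.Injective L) ∧
      ∀ A : Set V, μH[finrank ℝ V] (L '' A) = c * μH[finrank ℝ V] A := by
  set R := LinearMap.range (L : V →ₗ[ℝ] E) with hR
  by_cases hL : Function.Injective L
  · set f : V ≃L[ℝ] R :=
      (LinearEquiv.ofInjective (L : V →ₗ[ℝ] E) hL).toContinuousLinearEquiv with hf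
    have hfin : finrank ℝ R = finrank ℝ V := f.toLinearEquiv.finrank_eq.symm
    have hHaar : Measure.IsAddHaarMeasure (μH[finrank ℝ V] : Measure R) := by
      rw [← hfin]; infer_instance
    have hHaar' : Measure.IsAddHaarMeasure (Measure.map f.symm (μH[finrank ℝ V] : Measure R)) :=
      f.symm.isAddHaarMeasure_map _
    -- Uniqueness of Haar measure on `V`.
    obtain ⟨c, hc⟩ : ∃ c : ℝ≥0, Measure.map f.symm (μH[finrank ℝ V] : Measure R) =
        c • (μH[finrank ℝ V] : Measure V) := ⟨_, Measure.isAddLeftInvariant_eq_smul _ _⟩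
    refine ⟨c, iff_of_true (fun h0 => ?_) hL, fun A => ?_⟩
    · rw [h0, zero_smul] at hc
      exact NeZero.ne _ hc
    · have h1 : (Measure.map f.symm (μH[finrank ℝ V] : Measure R)) A =
          μH[finrank ℝ V] (L '' A) := by
        have h2 := f.symm.toHomeomorph.toMeasurableEquiv.map_apply
          (μ := (μH[finrank ℝ V] : Measure R)) A
        refine h2.trans ?_
        rw [← isometry_subtype_coe.hausdorffMeasure_image (Or.inl (Nat.cast_nonneg _))]
        congr 1
        ext x
        constructor
        · rintro ⟨y, hy, rfl⟩
          exact ⟨f.symm y, hy, congrArg Subtype.val (f.apply_symm_apply y)⟩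
        · rintro ⟨v, hv, rfl⟩
          exact ⟨f v, by
            change f.symm (f v) ∈ A
            rwa [f.symm_apply_apply], rfl⟩
      rw [← h1, hc]
      rfl
  · refine ⟨0, by simp [hL], fun A => ?_⟩
    have hlt : finrank ℝ R < finrank ℝ V := by
      refine lt_of_le_of_ne (LinearMap.finrank_range_le _) fun h => hL ?_
      have h1 := (L : V →ₗ[ℝ] E).finrank_range_add_finrank_ker
      have h2 : finrank ℝ (LinearMap.ker (L : V →ₗ[ℝ] E)) = 0 := by
        rw [← hR] at h1; omega
      exact LinearMap.ker_eq_bot.1 (Submodule.finrank_eq_zero.1 h2)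
    have h0 : (μH[finrank ℝ V] : Measure R) = 0 :=
      Real.hausdorffMeasure_of_finrank_lt (by exact_mod_cast hlt)
    rw [ENNReal.coe_zero, zero_mul]
    have hsub : L '' A ⊆ (Subtype.val : R → E) '' Set.univ := by
      rintro _ ⟨v, -, rfl⟩
      exact ⟨⟨L v, v, rfl⟩, trivial, rfl⟩
    refine measure_mono_null hsub ?_
    rw [isometry_subtype_coe.hausdorffMeasure_image (Or.inl (Nat.cast_nonneg _)), h0]
    rfl

/-- The correspondence `g x ↦ f x` is well defined and `K`-Lipschitz on `g '' s`, even if `g` is not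
injective. -/
theorem hausdorffMeasure_image_le_of_forall_mul_edist_le {α E F : Type*} [EMetricSpace E]
    [MeasurableSpace E] [BorelSpace E] [EMetricSpace F] [MeasurableSpace F] [BorelSpace F]
    {f : α → E} {g : α → F} {s : Set α} {K : ℝ≥0}
    (h : ∀ x ∈ s, ∀ y ∈ s, edist (f x) (f y) ≤ K * edist (g x) (g y)) {d : ℝ} (hd : 0 ≤ d) :
    μH[d] (f '' s) ≤ (K : ℝ≥0∞) ^ d * μH[d] (g '' s) := by
  rcases s.eq_empty_or_nonempty with rfl | ⟨x₀, -⟩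
  · simp
  have : Nonempty α := ⟨x₀⟩
  have hinv : ∀ p ∈ g '' s, Function.invFunOn g s p ∈ s ∧ g (Function.invFunOn g s p) = p :=
    fun p hp => ⟨Function.invFunOn_mem hp, Function.invFunOn_eq hp⟩
  have hlip : LipschitzOnWith K (f ∘ Function.invFunOn g s) (g '' s) := by
    intro p hp q hq
    have := h _ (hinv p hp).1 _ (hinv q hq).1
    rwa [(hinv p hp).2, (hinv q hq).2] at this
  convert hlip.hausdorffMeasure_image_le hd using 2
  ext z
  constructor
  · rintro ⟨x, hx, rfl⟩
    refine ⟨g x, ⟨x, hx, rfl⟩, ?_⟩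
    have hp := hinv (g x) ⟨x, hx, rfl⟩
    have := h _ hp.1 _ hx
    rw [hp.2, edist_self, mul_zero] at this
    exact edist_le_zero.1 this
  · rintro ⟨p, hp, rfl⟩
    exact ⟨_, (hinv p hp).1, rfl⟩

variable {X : Type*} [NormedAddCommGroup X] [InnerProductSpace ℝ X] [FiniteDimensional ℝ X]
  {E : Type*} [NormedAddCommGroup E] [NormedSpace ℝ E] [FiniteDimensional ℝ E]
  [MeasurableSpace E] [BorelSpace E] {m : ℕ}

/-- The unit ball of `V`, with respect to the inner product norm. -/
def Grass.unitBall (V : Grass X m) : Set X := (V.1 : Set X) ∩ Metric.closedBall 0 1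

/-- The `m`-dimensional Hausdorff measure, after the identification `e` of `X` with a normed space
`E`, of the image under `T` of the unit ball of `V`. -/
noncomputable def imageVol (e : X ≃L[ℝ] E) (V : Grass X m) (T : X →L[ℝ] X) : ℝ≥0∞ :=
  μH[m] (e '' (T '' V.unitBall))

/-- Both sides are multiples of the Euclidean Hausdorff measure on `V`; `c` is the quotient of the
two factors. -/
theorem exists_hausdorffMeasure_image_image_eq_mul (e : X ≃L[ℝ] E) (V : Grass X m)
    (T : X →L[ℝ] X) : ∃ c : ℝ≥0,
      (c ≠ 0 ↔ Function.Injective (((e : X →L[ℝ] E).comp T).comp V.1.subtypeL)) ∧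
      ∀ A ⊆ (V.1 : Set X), μH[m] (e '' (T '' A)) = c * μH[m] (e '' A) := by
  let : MeasurableSpace V.1 := borel V.1
  have : BorelSpace V.1 := ⟨rfl⟩
  obtain ⟨c₁, h₁, hc₁⟩ := exists_hausdorffMeasure_image_eq_mul
    ((e : X →L[ℝ] E).comp V.1.subtypeL)
  obtain ⟨c₂, h₂, hc₂⟩ := exists_hausdorffMeasure_image_eq_mul
    (((e : X →L[ℝ] E).comp T).comp V.1.subtypeL)
  have h₁' := h₁.2 (e.injective.comp Subtype.val_injective)
  simp only [V.2] at hc₁ hc₂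
  refine ⟨c₂ / c₁, by rw [← h₂]; simp [h₁'], fun A hA => ?_⟩
  have hA' : A = Subtype.val '' ((Subtype.val : V.1 → X) ⁻¹' A) :=
    (Set.image_preimage_eq_of_subset (by simpa using hA)).symm
  have e₁ : e '' A =
      ((e : X →L[ℝ] E).comp V.1.subtypeL) '' ((Subtype.val : V.1 → X) ⁻¹' A) := by
    conv_lhs => rw [hA', Set.image_image]
    rfl
  have e₂ : e '' (T '' A) = (((e : X →L[ℝ] E).comp T).comp V.1.subtypeL) ''
      ((Subtype.val : V.1 → X) ⁻¹' A) := by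
    conv_lhs => rw [hA', Set.image_image, Set.image_image]
    rfl
  rw [e₁, e₂, hc₁, hc₂, ← mul_assoc, ← ENNReal.coe_mul, div_mul_cancel₀ _ h₁']

theorem imageVol_id_ne_zero_ne_top (e : X ≃L[ℝ] E) (V : Grass X m) :
    imageVol e V (.id ℝ X) ≠ 0 ∧ imageVol e V (.id ℝ X) ≠ ∞ := by
  let : MeasurableSpace V.1 := borel V.1
  have : BorelSpace V.1 := ⟨rfl⟩
  obtain ⟨c₁, h₁, hc₁⟩ := exists_hausdorffMeasure_image_eq_mul
    ((e : X →L[ℝ] E).comp V.1.subtypeL)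
  have h₁' := h₁.2 (e.injective.comp Subtype.val_injective)
  have e₁ : imageVol e V (.id ℝ X) = c₁ * μH[finrank ℝ V.1] (Metric.closedBall (0 : V.1) 1) := by
    rw [← hc₁, V.2, imageVol]
    congr 1
    ext x
    constructor
    · rintro ⟨_, ⟨y, hy, rfl⟩, rfl⟩
      exact ⟨⟨y, hy.1⟩, by simpa using hy.2, rfl⟩
    · rintro ⟨y, hy, rfl⟩
      exact ⟨y, ⟨y, ⟨y.2, by simpa using hy⟩, rfl⟩, rfl⟩
  rw [e₁]
  refine ⟨mul_ne_zero (by exact_mod_cast h₁') ?_, ENNReal.mul_ne_top ENNReal.coe_ne_top ?_⟩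
  · exact (Metric.measure_closedBall_pos _ _ one_pos).ne'
  · exact measure_closedBall_lt_top.ne

theorem exists_imageVol_eq_mul (e : X ≃L[ℝ] E) (V : Grass X m) (T : X →L[ℝ] X) : ∃ c : ℝ≥0,
    (c ≠ 0 ↔ Function.Injective (((e : X →L[ℝ] E).comp T).comp V.1.subtypeL)) ∧
    imageVol e V T = c * imageVol e V (.id ℝ X) ∧
    ∀ A ⊆ (V.1 : Set X), μH[m] (e '' (T '' A)) = c * μH[m] (e '' A) := by
  obtain ⟨c, h, hc⟩ := exists_hausdorffMeasure_image_image_eq_mul e V T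
  refine ⟨c, h, ?_, hc⟩
  rw [imageVol, hc V.unitBall Set.inter_subset_left]
  simp [imageVol]

/-- Separating the dependence on `T` from that on `A` lets the integral over `T` be taken
independently of `A`. -/
theorem hausdorffMeasure_image_image_eq_imageVol_mul (e : X ≃L[ℝ] E) (V : Grass X m)
    (T : X →L[ℝ] X) {A : Set X} (hA : A ⊆ V.1) :
    μH[m] (e '' (T '' A)) =
      imageVol e V T * ((imageVol e V (.id ℝ X))⁻¹ * μH[m] (e '' A)) := by
  obtain ⟨c, -, h, hc⟩ := exists_imageVol_eq_mul e V T
  obtain ⟨h0, htop⟩ := imageVol_id_ne_zero_ne_top e V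
  rw [hc A hA, h, mul_assoc, ← mul_assoc (imageVol e V _), ENNReal.mul_inv_cancel h0 htop, one_mul]

theorem imageVol_ne_top (e : X ≃L[ℝ] E) (V : Grass X m) (T : X →L[ℝ] X) :
    imageVol e V T ≠ ∞ := by
  obtain ⟨c, -, h, -⟩ := exists_imageVol_eq_mul e V T
  rw [h]
  exact ENNReal.mul_ne_top ENNReal.coe_ne_top (imageVol_id_ne_zero_ne_top e V).2

theorem Grass.continuous_proj : Continuous (Grass.proj : Grass X m → (X →L[ℝ] X)) :=
  (isClosedEmbedding_grassProj X m).continuous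

/-- If `T₀` is not injective on `V₀`, the value there is zero. Otherwise, for `(V, T)` near `(V₀,
T₀)`, the map `T ∘ π_V` shrinks lengths on `V₀` by at most a factor near `1` relative to `T₀`, and
`π_V` sends the unit ball of `V₀` into that of `V`. -/
theorem lowerSemicontinuous_imageVol (e : X ≃L[ℝ] E) :
    LowerSemicontinuous fun p : Grass X m × (X →L[ℝ] X) => imageVol e p.1 p.2 := by
  rintro ⟨V₀, T₀⟩ y hy
  by_cases hinj : Function.Injective (((e : X →L[ℝ] E).comp T₀).comp V₀.1.subtypeL)
  swap
  · exfalso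
    obtain ⟨c, h, hc, -⟩ := exists_imageVol_eq_mul e V₀ T₀
    have hc0 : c = 0 := by
      by_contra h0
      exact hinj (h.1 h0)
    rw [hc0] at hc
    simp [hc] at hy
  obtain ⟨K, hK, hKL⟩ := LinearMap.exists_antilipschitzWith
    (((e : X →L[ℝ] E).comp T₀).comp V₀.1.subtypeL : V₀.1 →ₗ[ℝ] E) (LinearMap.ker_eq_bot.2 hinj)
  have hK' : ∀ v ∈ V₀.1, ‖v‖ ≤ K * ‖e (T₀ v)‖ := by
    intro v hv
    have := hKL.le_mul_dist ⟨v, hv⟩ 0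
    simpa using this
  -- `θ` bounds the relative error: `‖e (T (π_V v)) - e (T₀ v)‖ ≤ θ ‖e (T₀ v)‖` for `v ∈ V₀`.
  set θ : Grass X m × (X →L[ℝ] X) → ℝ := fun p =>
    K * ‖(e : X →L[ℝ] E).comp (p.2.comp p.1.proj - T₀.comp V₀.proj)‖ with hθ
  have hθc : Continuous θ := by
    have h1 : Continuous fun p : Grass X m × (X →L[ℝ] X) => p.1.proj :=
      Grass.continuous_proj.comp continuous_fst
    have h2 : Continuous fun p : Grass X m × (X →L[ℝ] X) => p.2.comp p.1.proj :=
      continuous_snd.clm_comp h1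
    exact continuous_const.mul (continuous_const.clm_comp (h2.sub continuous_const)).norm
  have hθ0 : θ (V₀, T₀) = 0 := by simp [hθ]
  have key : ∀ p, θ p < 1 →
      ENNReal.ofReal ((1 - θ p) ^ m) * imageVol e V₀ T₀ ≤ imageVol e p.1 p.2 := by
    intro p hp
    have hpos : 0 < 1 - θ p := sub_pos.2 hp
    have hbound : ∀ v ∈ V₀.1, ‖e (T₀ v)‖ ≤ (1 - θ p)⁻¹ * ‖e (p.2 (p.1.proj v))‖ := by
      intro v hv
      rw [inv_mul_eq_div, le_div_iff₀ hpos]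
      have hv0 : V₀.proj v = v := Submodule.starProjection_eq_self_iff.2 hv
      have h1 := ((e : X →L[ℝ] E).comp (p.2.comp p.1.proj - T₀.comp V₀.proj)).le_opNorm v
      simp only [ContinuousLinearMap.comp_apply, sub_apply, hv0,
        ContinuousLinearEquiv.coe_coe, map_sub] at h1
      have h2 : ‖(e : X →L[ℝ] E).comp (p.2.comp p.1.proj - T₀.comp V₀.proj)‖ * ‖v‖ ≤
          θ p * ‖e (T₀ v)‖ := by
        rw [hθ]
        calc _ ≤ _ * (K * ‖e (T₀ v)‖) := mul_le_mul_of_nonneg_left (hK' v hv) (norm_nonneg _)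
          _ = _ := by ring
      have h3 := norm_sub_norm_le (e (T₀ v)) (e (p.2 (p.1.proj v)))
      rw [norm_sub_rev] at h3
      linarith
    have h4 := hausdorffMeasure_image_le_of_forall_mul_edist_le (s := V₀.unitBall)
      (f := fun v => e (T₀ v)) (g := fun v => e (p.2 (p.1.proj v)))
      (K := Real.toNNReal (1 - θ p)⁻¹) (d := m) (fun v hv w hw => by
        have := hbound (v - w) (V₀.1.sub_mem hv.1 hw.1)
        simp only [map_sub, ← dist_eq_norm] at this
        rw [edist_dist, edist_dist]
        change _ ≤ ENNReal.ofReal (1 - θ p)⁻¹ * _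
        rw [← ENNReal.ofReal_mul (inv_nonneg.2 hpos.le)]
        exact ENNReal.ofReal_le_ofReal this) (Nat.cast_nonneg m)
    have h5 : μH[m] ((fun v => e (p.2 (p.1.proj v))) '' V₀.unitBall) ≤ imageVol e p.1 p.2 := by
      refine measure_mono ?_
      rintro _ ⟨v, hv, rfl⟩
      refine ⟨_, ⟨p.1.proj v, ⟨Submodule.starProjection_apply_mem _ _, ?_⟩, rfl⟩, rfl⟩
      rw [mem_closedBall_zero_iff]
      exact (p.1.1.norm_starProjection_apply_le v).trans (mem_closedBall_zero_iff.1 hv.2)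
    have h6 : imageVol e V₀ T₀ = μH[m] ((fun v => e (T₀ v)) '' V₀.unitBall) := by
      rw [imageVol, Set.image_image]
    rw [h6]
    refine (mul_le_mul_right (h4.trans (mul_le_mul_right h5 _)) _).trans_eq ?_
    rw [← mul_assoc, ENNReal.rpow_natCast]
    change ENNReal.ofReal ((1 - θ p) ^ m) * ENNReal.ofReal (1 - θ p)⁻¹ ^ m * _ = _
    rw [← ENNReal.ofReal_pow (inv_nonneg.2 hpos.le), ← ENNReal.ofReal_mul (by positivity),
      ← mul_pow, mul_inv_cancel₀ hpos.ne', one_pow, ENNReal.ofReal_one, one_mul]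
  have hlim : Filter.Tendsto
      (fun p => ENNReal.ofReal ((1 - θ p) ^ m) * imageVol e V₀ T₀) (𝓝 (V₀, T₀))
      (𝓝 (imageVol e V₀ T₀)) := by
    have h7 : Continuous fun p => ENNReal.ofReal ((1 - θ p) ^ m) :=
      ENNReal.continuous_ofReal.comp ((continuous_const.sub hθc).pow m)
    have h8 := ENNReal.Tendsto.mul_const (b := imageVol e V₀ T₀) (h7.tendsto (V₀, T₀))
      (Or.inl (by simp [hθ0]))
    simpa [hθ0] using h8
  filter_upwards [hlim.eventually (lt_mem_nhds hy),
    (hθc.tendsto (V₀, T₀)).eventually (gt_mem_nhds (hθ0.trans_lt one_pos))] with p h1 h2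
  exact h1.trans_le (key p h2)

end HausdorffLinear

/-! ### The second norm as a normed space structure. -/

/-- The space `X` with the norm `ν`. -/
def NormedCopy {X : Type*} [AddCommGroup X] [Module ℝ X] (ν : Seminorm ℝ X)
    (_hν : ∀ x, ν x = 0 → x = 0) : Type _ := X

namespace NormedCopy

section

variable {X : Type*} [AddCommGroup X] [Module ℝ X] (ν : Seminorm ℝ X)
  (hν : ∀ x, ν x = 0 → x = 0)

instance : AddCommGroup (NormedCopy ν hν) := inferInstanceAs (AddCommGroup X)

instance : Module ℝ (NormedCopy ν hν) := inferInstanceAs (Module ℝ X)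

instance [FiniteDimensional ℝ X] : FiniteDimensional ℝ (NormedCopy ν hν) :=
  inferInstanceAs (FiniteDimensional ℝ X)

noncomputable instance : NormedAddCommGroup (NormedCopy ν hν) :=
  AddGroupNorm.toNormedAddCommGroup (E := NormedCopy ν hν)
    { toFun := ν
      map_zero' := map_zero ν
      add_le' := map_add_le_add ν
      neg' := map_neg_eq_map ν
      eq_zero_of_map_eq_zero' := hν }

noncomputable instance : NormedSpace ℝ (NormedCopy ν hν) where
  norm_smul_le a x := (map_smul_eq_mul ν a x).le

noncomputable instance : MeasurableSpace (NormedCopy ν hν) := borel _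

instance : BorelSpace (NormedCopy ν hν) := ⟨rfl⟩

theorem normEMetric_eq :
    normEMetric ν hν = (inferInstance : EMetricSpace (NormedCopy ν hν)) := by
  refine EMetricSpace.ext ?_
  ext x y
  exact ((edist_dist (α := NormedCopy ν hν) x y).trans
    (congrArg ENNReal.ofReal (dist_eq_norm (E := NormedCopy ν hν) x y))).symm

end

variable {X : Type*} [NormedAddCommGroup X] [InnerProductSpace ℝ X] [FiniteDimensional ℝ X]
  (ν : Seminorm ℝ X) (hν : ∀ x, ν x = 0 → x = 0)

/-- The identity map from `X` to `X` with the norm `ν`. -/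
noncomputable def equiv : X ≃L[ℝ] NormedCopy ν hν :=
  LinearEquiv.toContinuousLinearEquiv (F := NormedCopy ν hν) (LinearEquiv.refl ℝ X)

end NormedCopy

/-! ### Density contractors form a Borel set. -/

section DensityContractor

variable {X : Type*} [NormedAddCommGroup X] [InnerProductSpace ℝ X] [FiniteDimensional ℝ X]
  (ν : Seminorm ℝ X) (hν : ∀ x, ν x = 0 → x = 0) {m : ℕ}

theorem exists_normHausdorff_eq_mul (m : ℕ) : ∃ c : ℝ≥0∞, c ≠ 0 ∧ c ≠ ∞ ∧
    ∀ S : Set X, normHausdorff ν hν m S = c * μH[m] (NormedCopy.equiv ν hν '' S) := by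
  refine ⟨volume (Metric.ball (0 : EuclideanSpace ℝ (Fin m)) 1) / 2 ^ m, ?_, ?_, fun S => ?_⟩
  · exact (ENNReal.div_pos (Metric.measure_ball_pos _ _ one_pos).ne' (by finiteness)).ne'
  · exact ENNReal.div_ne_top measure_ball_lt_top.ne (by positivity)
  · have h1 : NormedCopy.equiv ν hν '' S = S := by
      change id '' S = S
      exact Set.image_id S
    rw [normHausdorff, smul_apply, smul_eq_mul, h1, NormedCopy.normEMetric_eq]
    congr 1
    rw [Measure.hausdorffMeasure, ← OuterMeasure.coe_mkMetric]
    simp only [ENNReal.rpow_natCast]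
    rfl

theorem isClosed_setOf_finrank_range_le (X : Type*) [NormedAddCommGroup X]
    [InnerProductSpace ℝ X] [FiniteDimensional ℝ X] (m : ℕ) :
    IsClosed {π : X →L[ℝ] X | finrank ℝ (LinearMap.range (π : X →ₗ[ℝ] X)) ≤ m} := by
  have h := (isOpen_setOfPred_nat_le_rank (𝕜 := ℝ) (E := X) (F := X) (m + 1)).isClosed_compl
  convert h using 1
  ext π
  simp only [Set.mem_compl_iff, Set.mem_ofPred_eq, not_le]
  rw [LinearMap.rank, ← finrank_eq_rank, Nat.cast_lt, Nat.lt_succ_iff]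

instance (X : Type*) [NormedAddCommGroup X] [InnerProductSpace ℝ X] [FiniteDimensional ℝ X]
    (m : ℕ) : ProperSpace (HomRankLE X m) :=
  have : ProperSpace (X →L[ℝ] X) := FiniteDimensional.proper_real _
  .of_isClosed (isClosed_setOf_finrank_range_le X m)

theorem range_le_iff_proj_comp_eq (W : Grass X m) (π : X →L[ℝ] X) :
    LinearMap.range (π : X →ₗ[ℝ] X) ≤ W.1 ↔ W.proj.comp π = π := by
  constructor
  · intro h
    ext x
    exact Submodule.starProjection_eq_self_iff.2 (h ⟨x, rfl⟩)
  · rintro h _ ⟨x, rfl⟩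
    exact Submodule.starProjection_eq_self_iff.1 (DFunLike.congr_fun h x)

/-- For `A ⊆ V` both sides of the integral condition are proportional to the measure of `A`, so
testing the unit ball, whose measure is positive and finite, suffices. -/
theorem isDensityContractor_iff [MeasurableSpace X] [BorelSpace X] (W : Grass X m)
    (μ : ProbabilityMeasure (HomRankLE X m)) :
    IsDensityContractor ν hν W μ ↔
      ((μ : Measure (HomRankLE X m)) {π | W.proj.comp π.1 ≠ π.1} = 0 ∧
      ∀ V : Grass X m, ∫⁻ π, imageVol (NormedCopy.equiv ν hν) V π.1 ∂(μ : Measure (HomRankLE X m)) ≤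
        imageVol (NormedCopy.equiv ν hν) V (.id ℝ X)) ∧
      ∫⁻ π, imageVol (NormedCopy.equiv ν hν) W π.1 ∂(μ : Measure (HomRankLE X m)) =
        imageVol (NormedCopy.equiv ν hν) W (.id ℝ X) := by
  set e := NormedCopy.equiv ν hν
  obtain ⟨c, hc0, hct, hc⟩ := exists_normHausdorff_eq_mul ν hν m
  have hmeas : ∀ V : Grass X m, Measurable fun π : HomRankLE X m => imageVol e V π.1 := fun V =>
    LowerSemicontinuous.measurable fun π y hy =>
      ((Continuous.prodMk_right V).comp continuous_subtype_val).tendsto π |>.eventually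
        (lowerSemicontinuous_imageVol e (V, π.1) y hy)
  have hball : ∀ V : Grass X m, MeasurableSet V.unitBall := fun V =>
    (Submodule.closed_of_finiteDimensional V.1).measurableSet.inter
      Metric.isClosed_closedBall.measurableSet
  have hint : ∀ V : Grass X m, ∀ A ⊆ (V.1 : Set X),
      ∫⁻ π, normHausdorff ν hν m (π.1 '' A) ∂(μ : Measure (HomRankLE X m)) =
        (∫⁻ π, imageVol e V π.1 ∂(μ : Measure (HomRankLE X m))) *
          ((imageVol e V (.id ℝ X))⁻¹ * normHausdorff ν hν m A) := by
    intro V A hA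
    rw [← lintegral_mul_const _ (hmeas V)]
    refine lintegral_congr fun π => ?_
    rw [hc, hc, hausdorffMeasure_image_image_eq_imageVol_mul e V π.1 hA]
    ring
  have hvol : ∀ V : Grass X m, normHausdorff ν hν m V.unitBall = c * imageVol e V (.id ℝ X) := by
    intro V
    rw [hc, imageVol]
    simp [e]
  have hint' : ∀ V : Grass X m,
      ∫⁻ π, normHausdorff ν hν m (π.1 '' V.unitBall) ∂(μ : Measure (HomRankLE X m)) =
        c * ∫⁻ π, imageVol e V π.1 ∂(μ : Measure (HomRankLE X m)) := by
    intro V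
    rw [← lintegral_const_mul _ (hmeas V)]
    exact lintegral_congr fun π => hc _
  have hone : ∀ V : Grass X m, ∀ A, imageVol e V (.id ℝ X) *
      ((imageVol e V (.id ℝ X))⁻¹ * normHausdorff ν hν m A) = normHausdorff ν hν m A := by
    intro V A
    obtain ⟨h0, htop⟩ := imageVol_id_ne_zero_ne_top e V
    rw [← mul_assoc, ENNReal.mul_inv_cancel h0 htop, one_mul]
  constructor
  · rintro ⟨h1, h2, h3⟩
    refine ⟨⟨?_, fun V => ?_⟩, ?_⟩
    · simpa only [range_le_iff_proj_comp_eq] using h1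
    · have := h2 V V.unitBall (hball V) Set.inter_subset_left
      rw [hint', hvol] at this
      exact (ENNReal.mul_le_mul_iff_right hc0 hct).1 this
    · have := h3 W.unitBall (hball W) Set.inter_subset_left
      rw [hint', hvol] at this
      exact (ENNReal.mul_right_inj hc0 hct).1 this
  · rintro ⟨⟨h1, h2⟩, h3⟩
    refine ⟨?_, fun V A _ hA => ?_, fun A _ hA => ?_⟩
    · simpa only [range_le_iff_proj_comp_eq] using h1
    · rw [hint V A hA]
      exact (mul_le_mul_left (h2 V) _).trans_eq (hone V A)
    · rw [hint W A hA, h3, hone W A]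

theorem measurableSet_setOf_isDensityContractor [MeasurableSpace X] [BorelSpace X] (m : ℕ) :
    MeasurableSet[borel (Grass X m × ProbabilityMeasure (HomRankLE X m))]
      {p : Grass X m × ProbabilityMeasure (HomRankLE X m) |
        IsDensityContractor ν hν p.1 p.2} := by
  let _ : MeasurableSpace (Grass X m × ProbabilityMeasure (HomRankLE X m)) := borel _
  have _ : BorelSpace (Grass X m × ProbabilityMeasure (HomRankLE X m)) := ⟨rfl⟩
  set e := NormedCopy.equiv ν hν
  have hlsc : LowerSemicontinuous fun p : Grass X m × HomRankLE X m => imageVol e p.1 p.2.1 :=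
    fun p y hy => (continuous_fst.prodMk (continuous_subtype_val.comp continuous_snd)).tendsto p
      |>.eventually (lowerSemicontinuous_imageVol e (p.1, p.2.1) y hy)
  set U : Set (Grass X m × HomRankLE X m) := {p | p.1.proj.comp p.2.1 ≠ p.2.1} with hU
  have hUo : IsOpen U := by
    have h1 : Continuous fun p : Grass X m × HomRankLE X m => p.1.proj.comp p.2.1 :=
      (Grass.continuous_proj.comp continuous_fst).clm_comp
        (continuous_subtype_val.comp continuous_snd)
    exact isOpen_ne_fun h1 (continuous_subtype_val.comp continuous_snd)
  have hS₁ : IsClosed {p : Grass X m × ProbabilityMeasure (HomRankLE X m) |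
      (p.2 : Measure (HomRankLE X m)) {π | p.1.proj.comp π.1 ≠ π.1} = 0} := by
    have h := lowerSemicontinuous_lintegral_prod (f := U.indicator fun _ => (1 : ℝ≥0∞))
      (hUo.lowerSemicontinuous_indicator zero_le_one) (fun p => by
        by_cases hp : p ∈ U <;> simp [hp])
    convert h.isClosed_preimage 0 using 1
    ext p
    have h2 : MeasurableSet {π : HomRankLE X m | p.1.proj.comp π.1 ≠ π.1} :=
      (hUo.preimage (Continuous.prodMk_right p.1)).measurableSet
    have h3 : ∫⁻ x, U.indicator (fun _ => (1 : ℝ≥0∞)) (p.1, x) ∂(p.2 : Measure (HomRankLE X m)) =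
        (p.2 : Measure (HomRankLE X m)) {π | p.1.proj.comp π.1 ≠ π.1} := by
      rw [← lintegral_indicator_one h2]
      rfl
    simp only [Set.mem_preimage, Set.mem_Iic, h3, nonpos_iff_eq_zero, Set.mem_ofPred_eq]
  have hS₂ : ∀ V : Grass X m, IsClosed {p : Grass X m × ProbabilityMeasure (HomRankLE X m) |
      ∫⁻ π, imageVol e V π.1 ∂(p.2 : Measure (HomRankLE X m)) ≤ imageVol e V (.id ℝ X)} := by
    intro V
    have h := lowerSemicontinuous_lintegral_prod (Y := Grass X m)
      (f := fun p : Grass X m × HomRankLE X m => imageVol e V p.2.1)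
      (fun p y hy => (continuous_const.prodMk continuous_snd).tendsto p |>.eventually
        (hlsc (V, p.2) y hy)) (fun p => imageVol_ne_top e V p.2.1)
    exact h.isClosed_preimage _
  have hS₃ : MeasurableSet {p : Grass X m × ProbabilityMeasure (HomRankLE X m) |
      ∫⁻ π, imageVol e p.1 π.1 ∂(p.2 : Measure (HomRankLE X m)) =
        imageVol e p.1 (.id ℝ X)} := by
    refine measurableSet_eq_fun (LowerSemicontinuous.measurable ?_)
      (LowerSemicontinuous.measurable ?_)
    · exact lowerSemicontinuous_lintegral_prod hlsc fun p => imageVol_ne_top e p.1 p.2.1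
    · exact fun p y hy => (continuous_fst.prodMk continuous_const).tendsto p |>.eventually
        (lowerSemicontinuous_imageVol e (p.1, .id ℝ X) y hy)
  simp only [isDensityContractor_iff]
  -- The intersection over `V` is uncountable, so it is taken among closed sets, before passing to
  -- measurability.
  refine MeasurableSet.inter (IsClosed.inter hS₁ ?_).measurableSet hS₃
  have h := isClosed_iInter hS₂
  rwa [← Set.ofPred_forall] at h

end DensityContractor

theorem mainTheorem12 {X : Type*} [NormedAddCommGroup X] [InnerProductSpace ℝ X]
    [FiniteDimensional ℝ X] [MeasurableSpace X] [BorelSpace X]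
    (ν : Seminorm ℝ X) (hν : ∀ x, ν x = 0 → x = 0)
    (m : ℕ) (hm : 1 ≤ m) (hmX : m < finrank ℝ X) :
    MeasurableSet[borel (Grass X m × ProbabilityMeasure (HomRankLE X m))]
        {p : Grass X m × ProbabilityMeasure (HomRankLE X m) |
          IsDensityContractor ν hν p.1 p.2} ∧
      ((∀ W : Grass X m, ∃ μ : ProbabilityMeasure (HomRankLE X m),
          IsDensityContractor ν hν W μ) →
        ∃ μ : Grass X m → ProbabilityMeasure (HomRankLE X m),
          (∀ W : Grass X m, IsDensityContractor ν hν W (μ W)) ∧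
            UniversallyMeasurable μ) := by
  have hB := measurableSet_setOf_isDensityContractor ν hν m
  refine ⟨hB, fun h => ?_⟩
  let _ : MeasurableSpace (Grass X m × ProbabilityMeasure (HomRankLE X m)) := borel _
  have _ : BorelSpace (Grass X m × ProbabilityMeasure (HomRankLE X m)) := ⟨rfl⟩
  have := polishSpace_probabilityMeasure (H := HomRankLE X m)
  exact exists_universallyMeasurable_selection (MeasurableSet.analyticSet hB) h
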